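/- For $a>0$, $z\ge 0$ and $\theta\in\mathbb{R}$ let $$K_a^2(z,\cos\theta)=J_0(z_a)+2\sum_{k=1}^{\infty}e^{-\frac{i\pi k}{a}}J_{\frac{2k}{a}}(z_a)\cos k\theta,\qquad z_a=\frac{2}{a}z^{a/2},$$ be the two dimensional radially deformed Fourier kernel, where $J_\nu$ is the Bessel function of the first kind; for $x,y\in\mathbb{R}^2\setminus\{0\}$ one puts $z=|x||y|$ and $\cos\theta=\langle x,y\rangle/z$. For $\nu\in\{\tfrac13,\tfrac23\}$, $w\ge 0$ and $\varphi\in\mathbb{R}$ define $$f_1(\nu,w,\varphi)=\frac14\operatorname{cosec}\varphi\int_0^{w}\sin[(w-t)\sin\varphi]\,\bigl[\cos 2\varphi\,J_\nu(t)+2\cos\varphi\,J_\nu'(t)-J_{\nu+2}(t)\bigr]\,dt,$$ $$f_2(\nu,w,\varphi)=\frac12\int_0^{w}\Bigl(\frac{\nu}{t}+\cos\varphi\Bigr)\sin[(w-t)\sin\varphi]\,J_\nu(t)\,dt,$$ where, if $\sin\varphi=0$, the factor $\operatorname{cosec}\varphi\,\sin[(w-t)\sin\varphi]$ in $f_1$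 is replaced by its limit $w-t$. **Theorem.** Let $z\ge 0$, $\theta\in\mathbb{R}$ and $z_6=z^3/3$. Then, for $a=6$, the series above converges absolutely, the integrals $\int_0^{z_6}$ that define $f_1(\tfrac k3,z_6,\varphi)$ and $f_2(\tfrac k3,z_6,\varphi)$, $k=1,2$, converge absolutely for every $\varphi\in\mathbb{R}$ (also with the factor $\sin[(z_6-t)\sin\varphi]$ in $f_1$ replaced by $z_6-t$), and $$\begin{aligned}K_6^2(z,\cos\theta)={}&\exp(-iz_6\cos 3\theta)+2e^{-\frac{i\pi}{6}}J_{\frac13}(z_6)\cos\theta+2e^{-\frac{i\pi}{3}}J_{\frac23}(z_6)\cos 2\theta\\ &+\sum_{k=1}^{2}e^{ik(\theta-\frac{\pi}{6})}\Bigl(f_1\bigl(\tfrac k3,z_6,3\theta-\tfrac\pi2\bigr)+i f_2\bigl(\tfrac k3,z_6,3\theta-\tfrac\pi2\bigr)\Bigr)\\ &+\sum_{k=1}^{2}e^{-ik(\theta+\frac{\pi}{6})}\Bigl(f_1\bigl(\tfrac k3,z_6,3\theta+\tfrac\pi2\bigr)-i f_2\bigl(\tfrac k3,z_6,3\theta+\tfrac\pi2\bigr)\Bigr).\end{aligned}$$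 -/

import Mathlib

/-- The Bessel function of the first kind `J_ν(t)` of real order `ν` at a real argument `t ≥ 0`:
`J_ν(t) = (t/2)^ν ∑_{n ≥ 0} (-1)^n / (n! Γ(ν + n + 1)) (t/2)^{2n}`. -/
noncomputable def besselJ (ν t : ℝ) : ℝ :=
  (t / 2) ^ ν *
    ∑' n : ℕ, (-1 : ℝ) ^ n / ((n.factorial : ℝ) * Real.Gamma (ν + n + 1)) * (t / 2) ^ (2 * n)

/-- The rescaled radial variable `z_a = (2 / a) z^{a / 2}`. -/
noncomputable def kernelVar (a z : ℝ) : ℝ := 2 / a * z ^ (a / 2)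

/-- The term of index `k` (used for `k ≥ 1`) of the series of the two dimensional kernel:
`2 e^{-iπk/a} J_{2k/a}(z_a) cos kθ` with `ξ = cos θ`; here `cos kθ = T_k(cos θ)`
is written through the Chebyshev polynomial `T_k` of the first kind. -/
noncomputable def kernelTerm (a z ξ : ℝ) (k : ℕ) : ℂ :=
  2 * Complex.exp (-(Complex.I * (Real.pi : ℂ) * (k : ℂ) / (a : ℂ)))
    * ((besselJ (2 * (k : ℝ) / a) (kernelVar a z) : ℝ) : ℂ)
    * (((Polynomial.Chebyshev.T ℝ (k : ℤ)).eval ξ : ℝ) : ℂ)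

/-- The two dimensional radially deformed Fourier kernel
`K_a^2(z, cos θ) = J_0(z_a) + 2 ∑_{k ≥ 1} e^{-iπk/a} J_{2k/a}(z_a) cos kθ`, for `a > 0`, `z ≥ 0`
and `ξ = cos θ ∈ [-1, 1]`, where `z = |x||y|` and `θ` is the angle between `x` and `y`. -/
noncomputable def deformedKernel2 (a z ξ : ℝ) : ℂ :=
  ((besselJ 0 (kernelVar a z) : ℝ) : ℂ) + ∑' k : ℕ, kernelTerm a z ξ (k + 1)

/-- The bracket `cos 2φ J_ν(t) + 2 cos φ J_ν'(t) - J_{ν+2}(t)`. -/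
noncomputable def f₁Bracket (ν φ t : ℝ) : ℝ :=
  Real.cos (2 * φ) * besselJ ν t + 2 * Real.cos φ * deriv (besselJ ν) t - besselJ (ν + 2) t

/-- `f₁(ν, z, φ) = ¼ cosec φ ∫₀^z sin((z - t) sin φ) [cos 2φ J_ν(t) + 2 cos φ J_ν'(t) - J_{ν+2}(t)] dt`.
Where `sin φ = 0` the expression has a removable singularity, and `cosec φ sin((z - t) sin φ)` is
replaced by its limit `z - t`. -/
noncomputable def f₁ (ν z φ : ℝ) : ℝ :=
  open Classical in
  if Real.sin φ = 0 then
    1 / 4 * ∫ t in (0 : ℝ)..z, (z - t) * f₁Bracket ν φ t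
  else
    1 / 4 * (1 / Real.sin φ) * ∫ t in (0 : ℝ)..z, Real.sin ((z - t) * Real.sin φ) * f₁Bracket ν φ t

/-- The integrand `(ν/t + cos φ) sin((z - t) sin φ) J_ν(t)` of `f₂`. -/
noncomputable def f₂Integrand (ν z φ t : ℝ) : ℝ :=
  (ν / t + Real.cos φ) * Real.sin ((z - t) * Real.sin φ) * besselJ ν t

/-- `f₂(ν, z, φ) = ½ ∫₀^z (ν/t + cos φ) sin((z - t) sin φ) J_ν(t) dt`. -/
noncomputable def f₂ (ν z φ : ℝ) : ℝ :=
  1 / 2 * ∫ t in (0 : ℝ)..z, f₂Integrand ν z φ t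

/-! For `a = 6` the order `2k/a` is `k/3`, and `2 e^{-iπk/6} cos kθ = e^{ikα} + e^{ikβ}` with `α = θ
- π/6`, `β = -(θ + π/6)`. Writing `k = 3m + j` splits each series `∑ e^{ikα} J_{k/3}(w)` into three
series `e^{ijα} ∑_m e^{imφ} J_{ν+m}(w)` with `ν = j/3`, `φ = 3α`; the terms `k = 1, 2` stay
explicit.

Let `S(t) = ∑_{m≥1} e^{imφ} J_{ν+m}(t)`. The relation `2 J_μ' = J_{μ-1} - J_{μ+1}` makes the
differentiated series close up (`hasDerivAt_besselSeries`): `S' = i sin φ · S + (e^{iφ} J_ν +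
J_{ν+1})/2`, with `S(0) = 0`. For `ν = 0` the two directions together with `J_0` satisfy a
homogeneous equation, whose solution is the exponential (`jacobi_anger`). For `ν > 0`, variation of
constants and integration by parts give `S = f₁ + i f₂` (`f₁_add_I_mul_f₂`). -/

/-! ### The entire part of the Bessel function -/

/-- The coefficients of the entire function `besselG μ`. -/
noncomputable def besselCoeff (μ : ℝ) (n : ℕ) : ℝ :=
  (-1 : ℝ) ^ n / ((n.factorial : ℝ) * Real.Gamma (μ + n + 1))

/-- The entire part of the Bessel function: `J_μ(t) = (t/2)^μ G_μ((t/2)^2)`. -/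
noncomputable def besselG (μ x : ℝ) : ℝ := ∑' n : ℕ, besselCoeff μ n * x ^ n

theorem besselJ_eq_rpow_mul_besselG (μ t : ℝ) :
    besselJ μ t = (t / 2) ^ μ * besselG μ ((t / 2) ^ 2) := by
  simp only [besselJ, besselG, besselCoeff, pow_mul]

/-- The source of all convergence below: factorial decay both in the power series index and in the
order `ν + m`. -/
theorem Gamma_mul_factorial_le {μ : ℝ} (hμ : 0 ≤ μ) (k : ℕ) :
    Real.Gamma (μ + 1) * (k.factorial : ℝ) ≤ Real.Gamma (μ + k + 1) := by
  induction k with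
  | zero => simp
  | succ k ih =>
    have hpos : 0 < μ + k + 1 := by positivity
    have hG : 0 < Real.Gamma (μ + 1) := Real.Gamma_pos_of_pos (by positivity)
    rw [show μ + ((k + 1 : ℕ) : ℝ) + 1 = (μ + k + 1) + 1 by push_cast; ring,
      Real.Gamma_add_one hpos.ne', Nat.factorial_succ]
    push_cast
    calc Real.Gamma (μ + 1) * (((k : ℝ) + 1) * k.factorial)
        = ((k : ℝ) + 1) * (Real.Gamma (μ + 1) * k.factorial) := by ring
      _ ≤ (μ + k + 1) * Real.Gamma (μ + k + 1) := by
        gcongr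
        linarith

theorem abs_besselCoeff_le {μ : ℝ} (hμ : 0 ≤ μ) (n : ℕ) :
    |besselCoeff μ n| ≤ (Real.Gamma (μ + 1))⁻¹ * ((n.factorial : ℝ))⁻¹ := by
  have hG : 0 < Real.Gamma (μ + 1) := Real.Gamma_pos_of_pos (by positivity)
  have hGn : 0 < Real.Gamma (μ + n + 1) := Real.Gamma_pos_of_pos (by positivity)
  have hn : (1 : ℝ) ≤ n.factorial := by exact_mod_cast n.factorial_pos
  have h := Gamma_mul_factorial_le hμ n
  rw [besselCoeff, abs_div, abs_pow, abs_neg, abs_one, one_pow, abs_of_pos (by positivity),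
    one_div, mul_inv, mul_comm]
  gcongr
  nlinarith

theorem abs_besselCoeff_mul_pow_le {μ x R : ℝ} (hμ : 0 ≤ μ) (hx : |x| ≤ R) (n : ℕ) :
    |besselCoeff μ n * x ^ n| ≤ (Real.Gamma (μ + 1))⁻¹ * (R ^ n / n.factorial) := by
  have hG : 0 < Real.Gamma (μ + 1) := Real.Gamma_pos_of_pos (by positivity)
  rw [abs_mul, abs_pow]
  calc |besselCoeff μ n| * |x| ^ n
      ≤ ((Real.Gamma (μ + 1))⁻¹ * ((n.factorial : ℝ))⁻¹) * R ^ n := by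
        gcongr
        exact abs_besselCoeff_le hμ n
    _ = _ := by ring

theorem summable_besselCoeff_mul_pow {μ : ℝ} (hμ : 0 ≤ μ) (x : ℝ) :
    Summable fun n => besselCoeff μ n * x ^ n :=
  Summable.of_norm_bounded ((Real.summable_pow_div_factorial |x|).mul_left _)
    fun n => abs_besselCoeff_mul_pow_le hμ le_rfl n

theorem abs_besselG_le {μ : ℝ} (hμ : 0 ≤ μ) (x : ℝ) :
    |besselG μ x| ≤ (Real.Gamma (μ + 1))⁻¹ * Real.exp |x| := by
  have h : HasSum (fun n : ℕ => (Real.Gamma (μ + 1))⁻¹ * (|x| ^ n / n.factorial))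
      ((Real.Gamma (μ + 1))⁻¹ * Real.exp |x|) := by
    rw [Real.exp_eq_exp_ℝ]
    exact (NormedSpace.expSeries_div_hasSum_exp |x|).mul_left _
  exact tsum_of_norm_bounded (f := fun n => besselCoeff μ n * x ^ n) h
    fun n => abs_besselCoeff_mul_pow_le hμ le_rfl n

theorem besselCoeff_succ (μ : ℝ) (n : ℕ) :
    besselCoeff μ (n + 1) * ((n : ℝ) + 1) = -besselCoeff (μ + 1) n := by
  have hn : (n : ℝ) + 1 ≠ 0 := by positivity
  have hf : (n.factorial : ℝ) ≠ 0 := by positivity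
  rw [besselCoeff, besselCoeff, Nat.factorial_succ, pow_succ,
    show μ + 1 + (n : ℝ) + 1 = μ + ((n + 1 : ℕ) : ℝ) + 1 by push_cast; ring]
  push_cast
  -- At a pole `Real.Gamma` is `0` and division by `0` gives `0`, so both sides vanish and no sign
  -- condition on `μ` is needed.
  rcases eq_or_ne (Real.Gamma (μ + ((n : ℝ) + 1) + 1)) 0 with h | h
  · simp [h]
  · field_simp

theorem hasDerivAt_besselG {μ : ℝ} (hμ : 0 ≤ μ) (x : ℝ) :
    HasDerivAt (besselG μ) (-besselG (μ + 1) x) x := by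
  have key : ∀ n : ℕ, ∀ y : ℝ, besselCoeff μ (n + 1) * (((n + 1 : ℕ) : ℝ) * y ^ n)
      = -(besselCoeff (μ + 1) n * y ^ n) := fun n y => by
    rw [← mul_assoc, ← neg_mul, ← besselCoeff_succ]
    push_cast
    ring
  have hd := hasDerivAt_tsum_of_isPreconnected
    (u := fun n : ℕ => (Real.Gamma (μ + 1 + 1))⁻¹ * ((|x| + 1) ^ n / n.factorial))
    (t := Metric.ball (0 : ℝ) (|x| + 1))
    (g := fun n y => besselCoeff μ (n + 1) * y ^ (n + 1))
    (g' := fun n y => -(besselCoeff (μ + 1) n * y ^ n)) (y₀ := x) (y := x)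
    ((Real.summable_pow_div_factorial _).mul_left _) Metric.isOpen_ball
    (convex_ball _ _).isPreconnected
    (fun n y _ => by
      rw [← key]
      exact (hasDerivAt_pow (n + 1) y).const_mul _)
    (fun n y hy => by
      rw [norm_neg]
      exact abs_besselCoeff_mul_pow_le (by positivity) (mem_ball_zero_iff.1 hy).le n)
    (by simp) ((summable_nat_add_iff 1).2 (summable_besselCoeff_mul_pow hμ x)) (by simp)
  rw [tsum_neg] at hd
  have heq : besselG μ = fun y => besselCoeff μ 0 + ∑' n : ℕ, besselCoeff μ (n + 1) * y ^ (n + 1) := by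
    funext y
    rw [besselG, (summable_besselCoeff_mul_pow hμ y).tsum_eq_zero_add]
    simp
  rw [heq]
  exact hd.const_add _

theorem continuous_besselG {μ : ℝ} (hμ : 0 ≤ μ) : Continuous (besselG μ) :=
  continuous_iff_continuousAt.2 fun x => (hasDerivAt_besselG hμ x).continuousAt

/-- The functional equation of Γ multiplies the coefficients of order `μ + 1` by `μ + 1 + n`; the
part `n` shifts the index and raises the order once more, by `besselCoeff_succ`. -/
theorem besselG_recurrence {μ : ℝ} (hμ : 0 ≤ μ) (x : ℝ) :
    besselG μ x = (μ + 1) * besselG (μ + 1) x - x * besselG (μ + 2) x := by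
  have h0 := summable_besselCoeff_mul_pow hμ x
  have h1 := summable_besselCoeff_mul_pow (μ := μ + 1) (by positivity) x
  have h2 := summable_besselCoeff_mul_pow (μ := μ + 2) (by positivity) x
  have hΓ : ∀ n : ℕ, Real.Gamma (μ + n + 1 + 1) = (μ + n + 1) * Real.Gamma (μ + n + 1) :=
    fun n => Real.Gamma_add_one (by positivity)
  have hcoeff : ∀ n : ℕ, besselCoeff μ n = (μ + 1 + n) * besselCoeff (μ + 1) n := fun n => by
    have hp : μ + n + 1 ≠ 0 := by positivity
    have hG : Real.Gamma (μ + n + 1) ≠ 0 := (Real.Gamma_pos_of_pos (by positivity)).ne'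
    have hf : (n.factorial : ℝ) ≠ 0 := by positivity
    rw [besselCoeff, besselCoeff, show μ + 1 + (n : ℝ) + 1 = μ + n + 1 + 1 by ring, hΓ]
    field_simp
    ring
  have hzero : besselCoeff μ 0 = (μ + 1) * besselCoeff (μ + 1) 0 := by simpa using hcoeff 0
  have hsucc : ∀ n : ℕ, besselCoeff μ (n + 1) * x ^ (n + 1)
      = (μ + 1) * (besselCoeff (μ + 1) (n + 1) * x ^ (n + 1))
        - x * (besselCoeff (μ + 2) n * x ^ n) := fun n => by
    have := besselCoeff_succ (μ + 1) n
    rw [show μ + 1 + 1 = μ + 2 by ring] at this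
    rw [hcoeff, pow_succ]
    push_cast
    linear_combination x ^ n * x * this
  rw [besselG, besselG, besselG, h0.tsum_eq_zero_add, h1.tsum_eq_zero_add]
  simp only [hsucc]
  rw [Summable.tsum_sub (((summable_nat_add_iff 1).2 h1).mul_left _) (h2.mul_left _),
    tsum_mul_left, tsum_mul_left, hzero]
  ring

/-! ### Continuity, derivative and recurrence of the Bessel function -/

theorem continuous_besselJ {μ : ℝ} (hμ : 0 ≤ μ) : Continuous (besselJ μ) := by
  have h : besselJ μ = fun t => (t / 2) ^ μ * besselG μ ((t / 2) ^ 2) :=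
    funext fun t => besselJ_eq_rpow_mul_besselG μ t
  rw [h]
  exact ((Real.continuous_rpow_const hμ).comp (continuous_id.div_const 2)).mul
    ((continuous_besselG hμ).comp ((continuous_id.div_const 2).pow 2))

theorem besselJ_at_zero {μ : ℝ} (hμ : 0 < μ) : besselJ μ 0 = 0 := by
  rw [besselJ, zero_div, Real.zero_rpow hμ.ne', zero_mul]

theorem besselJ_zero_at_zero : besselJ 0 0 = 1 := by
  rw [besselJ_eq_rpow_mul_besselG, zero_div, Real.rpow_zero, one_mul, besselG,
    tsum_eq_single 0 fun n hn => by simp [hn]]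
  simp [besselCoeff]

theorem hasDerivAt_besselJ {μ t : ℝ} (hμ : 0 ≤ μ) (ht : 0 < t) :
    HasDerivAt (besselJ μ) (μ / t * besselJ μ t - besselJ (μ + 1) t) t := by
  have h : besselJ μ = fun t => (t / 2) ^ μ * besselG μ ((t / 2) ^ 2) :=
    funext fun t => besselJ_eq_rpow_mul_besselG μ t
  have ht2 : t / 2 ≠ 0 := by positivity
  have hlin : HasDerivAt (fun s : ℝ => s / 2) (1 / 2) t := (hasDerivAt_id t).div_const 2
  have h1 := hlin.rpow_const (p := μ) (Or.inl ht2)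
  have hsq : HasDerivAt (fun s : ℝ => (s / 2) ^ 2) (2 * (t / 2) * (1 / 2)) t := by
    simpa using hlin.fun_pow 2
  have h2 := (hasDerivAt_besselG hμ ((t / 2) ^ 2)).comp t hsq
  rw [besselJ_eq_rpow_mul_besselG (μ + 1), besselJ_eq_rpow_mul_besselG μ t, h]
  convert! h1.mul h2 using 1
  rw [Real.rpow_add_one ht2, Real.rpow_sub_one ht2]
  simp only [Function.comp]
  field_simp
  ring

theorem besselJ_recurrence {μ t : ℝ} (hμ : 0 ≤ μ) (ht : 0 < t) :
    besselJ μ t + besselJ (μ + 2) t = 2 * (μ + 1) / t * besselJ (μ + 1) t := by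
  have ht2 : t / 2 ≠ 0 := by positivity
  rw [besselJ_eq_rpow_mul_besselG, besselJ_eq_rpow_mul_besselG, besselJ_eq_rpow_mul_besselG,
    besselG_recurrence hμ, show μ + 2 = μ + 1 + 1 by ring, Real.rpow_add_one ht2,
    Real.rpow_add_one ht2]
  field_simp
  ring

/-- The recurrence removes the factor `1/t`, which leaves constant coefficients; this is what lets
the differentiated series close up. -/
theorem hasDerivAt_besselJ_add_one {μ t : ℝ} (hμ : 0 ≤ μ) (ht : 0 < t) :
    HasDerivAt (besselJ (μ + 1)) ((besselJ μ t - besselJ (μ + 2) t) / 2) t := by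
  convert! hasDerivAt_besselJ (μ := μ + 1) (by positivity) ht using 1
  have h := besselJ_recurrence hμ ht
  rw [show μ + 1 + 1 = μ + 2 by ring]
  linear_combination (1 / 2 : ℝ) * h

/-! ### The series of Bessel modes and its differential equation -/

/-- A bound for `|J_{ν+m}|` on `[0, R]` that is summable in `m`. -/
noncomputable def besselMajorant (ν R : ℝ) (m : ℕ) : ℝ :=
  (R / 2) ^ ν * Real.exp ((R / 2) ^ 2) * (Real.Gamma (ν + 1))⁻¹ * ((R / 2) ^ m / m.factorial)

theorem summable_besselMajorant (ν R : ℝ) : Summable (besselMajorant ν R) :=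
  (Real.summable_pow_div_factorial _).mul_left _

theorem abs_besselJ_add_nat_le {ν t R : ℝ} (hν : 0 ≤ ν) (ht : 0 ≤ t) (htR : t ≤ R) (m : ℕ) :
    |besselJ (ν + m) t| ≤ besselMajorant ν R m := by
  have hG : 0 < Real.Gamma (ν + 1) := Real.Gamma_pos_of_pos (by positivity)
  have hR : 0 ≤ R := ht.trans htR
  have h1 : |besselG (ν + m) ((t / 2) ^ 2)|
      ≤ (Real.Gamma (ν + 1) * m.factorial)⁻¹ * Real.exp ((R / 2) ^ 2) := by
    refine (abs_besselG_le (by positivity) _).trans ?_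
    rw [abs_of_nonneg (by positivity)]
    gcongr
    exact Gamma_mul_factorial_le hν m
  rw [besselJ_eq_rpow_mul_besselG, abs_mul, abs_of_nonneg (by positivity), besselMajorant]
  calc (t / 2) ^ (ν + m) * |besselG (ν + m) ((t / 2) ^ 2)|
      ≤ (R / 2) ^ (ν + m) * ((Real.Gamma (ν + 1) * m.factorial)⁻¹ * Real.exp ((R / 2) ^ 2)) := by
        gcongr
    _ = _ := by
        rw [Real.rpow_add_of_nonneg (by positivity) hν (by positivity), Real.rpow_natCast, mul_inv]
        ring

/-- The mode `e^{imφ} J_{ν+m}(t)`. -/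
noncomputable def besselMode (ν φ : ℝ) (m : ℕ) (t : ℝ) : ℂ :=
  Complex.exp (((m * φ : ℝ) : ℂ) * Complex.I) * ((besselJ (ν + m) t : ℝ) : ℂ)

/-- The series `∑_{m ≥ 1} e^{imφ} J_{ν+m}(t)`. -/
noncomputable def besselSeries (ν φ t : ℝ) : ℂ := ∑' m : ℕ, besselMode ν φ (m + 1) t

theorem norm_besselMode_le {ν t R : ℝ} (φ : ℝ) (hν : 0 ≤ ν) (ht : 0 ≤ t) (htR : t ≤ R) (m : ℕ) :
    ‖besselMode ν φ m t‖ ≤ besselMajorant ν R m := by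
  rw [besselMode, norm_mul, Complex.norm_exp_ofReal_mul_I, one_mul, Complex.norm_real]
  exact abs_besselJ_add_nat_le hν ht htR m

theorem summable_besselMode {ν t : ℝ} (φ : ℝ) (hν : 0 ≤ ν) (ht : 0 ≤ t) :
    Summable fun m => besselMode ν φ m t :=
  Summable.of_norm_bounded (summable_besselMajorant ν t)
    fun m => norm_besselMode_le φ hν ht le_rfl m

theorem continuousOn_besselSeries {ν : ℝ} (φ : ℝ) (hν : 0 ≤ ν) (w : ℝ) :
    ContinuousOn (besselSeries ν φ) (Set.Icc 0 w) := by
  refine continuousOn_tsum (fun m => ?_) ((summable_nat_add_iff 1).2 (summable_besselMajorant ν w))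
    fun m t ht => norm_besselMode_le φ hν ht.1 ht.2 (m + 1)
  exact (continuous_const.mul (Complex.continuous_ofReal.comp
    (continuous_besselJ (by positivity)))).continuousOn

theorem besselSeries_zero {ν : ℝ} (φ : ℝ) (hν : 0 ≤ ν) : besselSeries ν φ 0 = 0 := by
  have h : ∀ m : ℕ, besselMode ν φ (m + 1) 0 = 0 := fun m => by
    rw [besselMode, besselJ_at_zero (by push_cast; positivity)]
    simp
  simp [besselSeries, h]

theorem hasDerivAt_besselMode_succ {ν t : ℝ} (φ : ℝ) (hν : 0 ≤ ν) (ht : 0 < t) (m : ℕ) :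
    HasDerivAt (besselMode ν φ (m + 1))
      ((Complex.exp (φ * Complex.I) * besselMode ν φ m t
        - Complex.exp (-(φ * Complex.I)) * besselMode ν φ (m + 2) t) / 2) t := by
  have hJ := (hasDerivAt_besselJ_add_one (μ := ν + m) (by positivity) ht).ofReal_comp
  rw [show ν + (m : ℝ) + 1 = ν + ((m + 1 : ℕ) : ℝ) by push_cast; ring,
    show ν + (m : ℝ) + 2 = ν + ((m + 2 : ℕ) : ℝ) by push_cast; ring] at hJ
  convert! hJ.const_mul (Complex.exp ((((m + 1 : ℕ) * φ : ℝ) : ℂ) * Complex.I)) using 1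
  have e1 : Complex.exp ((((m + 1 : ℕ) * φ : ℝ) : ℂ) * Complex.I)
      = Complex.exp (φ * Complex.I) * Complex.exp (((m * φ : ℝ) : ℂ) * Complex.I) := by
    rw [← Complex.exp_add]
    congr 1
    push_cast
    ring
  have e2 : Complex.exp ((((m + 1 : ℕ) * φ : ℝ) : ℂ) * Complex.I)
      = Complex.exp (-(φ * Complex.I))
        * Complex.exp ((((m + 2 : ℕ) * φ : ℝ) : ℂ) * Complex.I) := by
    rw [← Complex.exp_add]
    congr 1
    push_cast
    ring
  simp only [besselMode, Complex.ofReal_div, Complex.ofReal_sub, Complex.ofReal_ofNat]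
  linear_combination (-((besselJ (ν + m) t : ℝ) : ℂ) / 2) * e1
    + ((besselJ (ν + (m + 2 : ℕ)) t : ℝ) : ℂ) / 2 * e2

/-- Differentiation term by term shifts the modes down and up by one; up to the boundary modes `m =
0, 1` both shifts are again the series, with total factor `(e^{iφ} - e^{-iφ})/2 = i sin φ`. -/
theorem hasDerivAt_besselSeries {ν t : ℝ} (φ : ℝ) (hν : 0 ≤ ν) (ht : 0 < t) :
    HasDerivAt (besselSeries ν φ)
      (Complex.I * (Real.sin φ : ℂ) * besselSeries ν φ t
        + (Complex.exp (φ * Complex.I) * (besselJ ν t : ℂ) + (besselJ (ν + 1) t : ℂ)) / 2) t := by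
  have hs := summable_besselMode φ hν ht.le
  have hs1 := (summable_nat_add_iff 1).2 hs
  have hs2 := (summable_nat_add_iff 2).2 hs
  have hM := summable_besselMajorant ν (t + 1)
  have hd := hasDerivAt_tsum_of_isPreconnected
    (u := fun m => (besselMajorant ν (t + 1) m + besselMajorant ν (t + 1) (m + 2)) / 2)
    -- The mode derivatives are available only for positive arguments, so the domain is a bounded
    -- interval open at `0`.
    (t := Set.Ioo 0 (t + 1)) (g := fun m => besselMode ν φ (m + 1)) (y₀ := t) (y := t)
    ((hM.add ((summable_nat_add_iff 2).2 hM)).div_const 2) isOpen_Ioo isPreconnected_Ioo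
    (fun m y hy => hasDerivAt_besselMode_succ φ hν hy.1 m)
    (fun m y hy => by
      have h1 := norm_besselMode_le φ hν hy.1.le hy.2.le m
      have h2 := norm_besselMode_le φ hν hy.1.le hy.2.le (m + 2)
      rw [norm_div, Complex.norm_ofNat]
      refine div_le_div_of_nonneg_right ((norm_sub_le _ _).trans ?_) (by norm_num)
      rw [norm_mul, norm_mul, Complex.norm_exp_ofReal_mul_I, ← neg_mul, ← Complex.ofReal_neg,
        Complex.norm_exp_ofReal_mul_I, one_mul, one_mul]
      exact add_le_add h1 h2)
    ⟨ht, by linarith⟩ hs1 ⟨ht, by linarith⟩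
  convert! hd using 1
  rw [tsum_div_const, Summable.tsum_sub (hs.mul_left _) (hs2.mul_left _), tsum_mul_left,
    tsum_mul_left, hs.tsum_eq_zero_add]
  have h2 : ∑' m : ℕ, besselMode ν φ (m + 2) t = besselSeries ν φ t - besselMode ν φ 1 t := by
    rw [besselSeries, hs1.tsum_eq_zero_add]
    simp [add_assoc]
  rw [h2, ← besselSeries]
  have m0 : besselMode ν φ 0 t = (besselJ ν t : ℂ) := by simp [besselMode]
  have m1 : besselMode ν φ 1 t = Complex.exp (φ * Complex.I) * (besselJ (ν + 1) t : ℂ) := by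
    simp [besselMode]
  have hexp : Complex.exp (-(φ * Complex.I)) * Complex.exp (φ * Complex.I) = 1 := by
    rw [← Complex.exp_add, neg_add_cancel, Complex.exp_zero]
  have hsin : Complex.exp (φ * Complex.I) - Complex.exp (-(φ * Complex.I))
      = 2 * Complex.I * (Real.sin φ : ℂ) := by
    rw [← neg_mul, Complex.exp_mul_I, Complex.exp_mul_I, Complex.cos_neg, Complex.sin_neg,
      Complex.ofReal_sin]
    ring
  rw [m0, m1]
  linear_combination (-besselSeries ν φ t / 2) * hsin - (besselJ (ν + 1) t : ℂ) / 2 * hexp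

/-! ### The Jacobi–Anger expansion -/

theorem eq_of_hasDerivAt_zero {f : ℝ → ℂ} {w : ℝ} (hw : 0 ≤ w)
    (hc : ContinuousOn f (Set.Icc 0 w)) (hd : ∀ t ∈ Set.Ioo 0 w, HasDerivAt f 0 t) :
    f w = f 0 := by
  have h := intervalIntegral.integral_eq_sub_of_hasDerivAt_of_le (f' := fun _ => (0 : ℂ)) hw hc hd
    intervalIntegrable_const
  rw [intervalIntegral.integral_zero] at h
  exact (sub_eq_zero.1 h.symm)

/-- The Jacobi–Anger expansion. -/
theorem jacobi_anger {w : ℝ} (ψ : ℝ) (hw : 0 ≤ w) :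
    (besselJ 0 w : ℂ) + besselSeries 0 (ψ - Real.pi / 2) w
      + besselSeries 0 (-(ψ + Real.pi / 2)) w
      = Complex.exp (-(Complex.I * (w : ℂ) * (Real.cos ψ : ℂ))) := by
  set E : ℝ → ℂ := fun t => (besselJ 0 t : ℂ) + besselSeries 0 (ψ - Real.pi / 2) t
      + besselSeries 0 (-(ψ + Real.pi / 2)) t with hE
  set c : ℂ := Complex.I * (Real.cos ψ : ℂ) with hcdef
  -- Both angles have sine `-cos ψ`, and `J_0' = -J_1` cancels the two halves of `J_1`; hence `E' =
  -- -cE`, and `E e^{ct}` is constant.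
  have hconst := eq_of_hasDerivAt_zero (f := fun t : ℝ => E t * Complex.exp (c * t)) hw
    ((((Complex.continuous_ofReal.comp (continuous_besselJ le_rfl)).continuousOn.add
      (continuousOn_besselSeries _ le_rfl w)).add (continuousOn_besselSeries _ le_rfl w)).mul
      (by fun_prop)) (fun t ht => by
    have hJ := (hasDerivAt_besselJ le_rfl ht.1).ofReal_comp
    have h1 := hasDerivAt_besselSeries (ψ - Real.pi / 2) le_rfl ht.1
    have h2 := hasDerivAt_besselSeries (-(ψ + Real.pi / 2)) le_rfl ht.1
    have hexp : HasDerivAt (fun t : ℝ => Complex.exp (c * t)) (Complex.exp (c * t) * (c * 1)) t :=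
      ((hasDerivAt_id t).ofReal_comp.const_mul c).cexp
    refine ((((hJ.add h1).add h2).mul hexp).congr_deriv ?_)
    have s1 : Real.sin (ψ - Real.pi / 2) = -Real.cos ψ := Real.sin_sub_pi_div_two ψ
    have s2 : Real.sin (-(ψ + Real.pi / 2)) = -Real.cos ψ := by
      rw [Real.sin_neg, Real.sin_add_pi_div_two]
    have hsum : Complex.exp (((ψ - Real.pi / 2 : ℝ) : ℂ) * Complex.I)
        + Complex.exp (((-(ψ + Real.pi / 2) : ℝ) : ℂ) * Complex.I) = -2 * c := by
      rw [Complex.exp_mul_I, Complex.exp_mul_I, ← Complex.ofReal_cos, ← Complex.ofReal_sin,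
        ← Complex.ofReal_cos, ← Complex.ofReal_sin, s1, s2, Real.cos_sub_pi_div_two, Real.cos_neg,
        Real.cos_add_pi_div_two, hcdef]
      push_cast
      ring
    simp only [Pi.add_apply, s1, s2, zero_div, zero_mul, zero_sub, zero_add]
    push_cast
    rw [hcdef] at hsum ⊢
    push_cast at hsum ⊢
    linear_combination (Complex.exp (Complex.I * Complex.cos ψ * t) * (besselJ 0 t : ℂ) / 2) * hsum)
  have h0 : E 0 = 1 := by
    simp [hE, besselSeries_zero, besselJ_zero_at_zero]
  simp only [h0, Complex.ofReal_zero, mul_zero, Complex.exp_zero, mul_one] at hconst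
  change E w = _
  rw [Complex.exp_neg, show Complex.I * (w : ℂ) * (Real.cos ψ : ℂ) = c * w by rw [hcdef]; ring]
  exact eq_inv_of_mul_eq_one_left hconst

/-! ### Integral representations of the real and imaginary parts -/

/-- Near `0` the integrand is `t^{ν-1}` times a continuous function, which is integrable because `ν
> 0`. -/
theorem intervalIntegrable_besselJ_div {ν w : ℝ} (hν : 0 < ν) (hw : 0 ≤ w) :
    IntervalIntegrable (fun t => besselJ ν t / t) MeasureTheory.volume 0 w := by
  have h : IntervalIntegrable
      (fun t : ℝ => t ^ (ν - 1) * ((2 ^ ν)⁻¹ * besselG ν ((t / 2) ^ 2)))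
      MeasureTheory.volume 0 w :=
    (intervalIntegral.intervalIntegrable_rpow' (by linarith)).mul_continuousOn
      (continuous_const.mul ((continuous_besselG hν.le).comp
        ((continuous_id.div_const 2).pow 2))).continuousOn
  refine h.congr fun t ht => ?_
  rw [Set.uIoc_of_le hw] at ht
  have ht0 : t ≠ 0 := ht.1.ne'
  have h2 : (2 : ℝ) ^ ν ≠ 0 := (Real.rpow_pos_of_pos two_pos ν).ne'
  rw [besselJ_eq_rpow_mul_besselG, Real.div_rpow ht.1.le two_pos.le, Real.rpow_sub_one ht0]
  field_simp

theorem intervalIntegrable_deriv_besselJ {ν w : ℝ} (hν : 0 < ν) (hw : 0 ≤ w) :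
    IntervalIntegrable (deriv (besselJ ν)) MeasureTheory.volume 0 w := by
  have hJ : IntervalIntegrable (besselJ (ν + 1)) MeasureTheory.volume 0 w :=
    (continuous_besselJ (by positivity)).intervalIntegrable 0 w
  refine (((intervalIntegrable_besselJ_div hν hw).const_mul ν).sub hJ).congr fun t ht => ?_
  rw [Set.uIoc_of_le hw] at ht
  rw [(hasDerivAt_besselJ hν.le ht.1).deriv]
  ring

theorem intervalIntegrable_mul_f₁Bracket {ν w : ℝ} (hν : 0 < ν) (hw : 0 ≤ w) (φ : ℝ) {K : ℝ → ℝ}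
    (hK : Continuous K) :
    IntervalIntegrable (fun t => K t * f₁Bracket ν φ t) MeasureTheory.volume 0 w := by
  have h0 : IntervalIntegrable (besselJ ν) MeasureTheory.volume 0 w :=
    (continuous_besselJ hν.le).intervalIntegrable 0 w
  have h2 : IntervalIntegrable (besselJ (ν + 2)) MeasureTheory.volume 0 w :=
    (continuous_besselJ (by positivity)).intervalIntegrable 0 w
  have hB : IntervalIntegrable (f₁Bracket ν φ) MeasureTheory.volume 0 w :=
    ((h0.const_mul (Real.cos (2 * φ))).add
      ((intervalIntegrable_deriv_besselJ hν hw).const_mul (2 * Real.cos φ))).sub h2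
  exact hB.continuousOn_mul hK.continuousOn

theorem intervalIntegrable_f₂Integrand {ν w : ℝ} (hν : 0 < ν) (hw : 0 ≤ w) (φ : ℝ) :
    IntervalIntegrable (f₂Integrand ν w φ) MeasureTheory.volume 0 w := by
  have h0 : IntervalIntegrable (besselJ ν) MeasureTheory.volume 0 w :=
    (continuous_besselJ hν.le).intervalIntegrable 0 w
  have hB := ((intervalIntegrable_besselJ_div hν hw).const_mul ν).add
    (h0.const_mul (Real.cos φ))
  have hs : Continuous fun t : ℝ => Real.sin ((w - t) * Real.sin φ) := by fun_prop
  refine (hB.continuousOn_mul hs.continuousOn).congr fun t _ => ?_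
  simp only [f₂Integrand]
  ring

theorem hasDerivAt_besselSeries_re {ν t : ℝ} (φ : ℝ) (hν : 0 ≤ ν) (ht : 0 < t) :
    HasDerivAt (fun t => (besselSeries ν φ t).re)
      (-(Real.sin φ * (besselSeries ν φ t).im)
        + (Real.cos φ * besselJ ν t + besselJ (ν + 1) t) / 2) t := by
  refine (Complex.reCLM.hasFDerivAt.comp_hasDerivAt t
    (hasDerivAt_besselSeries φ hν ht)).congr_deriv ?_
  simp [Complex.exp_ofReal_mul_I_re, Complex.exp_ofReal_mul_I_im, -Complex.ofReal_sin]

theorem hasDerivAt_besselSeries_im {ν t : ℝ} (φ : ℝ) (hν : 0 ≤ ν) (ht : 0 < t) :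
    HasDerivAt (fun t => (besselSeries ν φ t).im)
      (Real.sin φ * (besselSeries ν φ t).re + Real.sin φ * besselJ ν t / 2) t := by
  refine (Complex.imCLM.hasFDerivAt.comp_hasDerivAt t
    (hasDerivAt_besselSeries φ hν ht)).congr_deriv ?_
  simp [Complex.exp_ofReal_mul_I_re, Complex.exp_ofReal_mul_I_im, -Complex.ofReal_sin]

theorem hasDerivAt_sub_mul (w s t : ℝ) : HasDerivAt (fun t : ℝ => (w - t) * s) (-s) t := by
  simpa using ((hasDerivAt_id t).const_sub w).mul_const s

theorem f₂_eq_besselSeries_im {ν w : ℝ} (hν : 0 < ν) (hw : 0 ≤ w) (φ : ℝ) :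
    f₂ ν w φ = (besselSeries ν φ w).im := by
  have hS := continuousOn_besselSeries φ hν.le w
  have hC : ContinuousOn (fun t => (besselSeries ν φ t).re) (Set.Icc 0 w) :=
    Complex.continuous_re.comp_continuousOn hS
  have hD : ContinuousOn (fun t => (besselSeries ν φ t).im) (Set.Icc 0 w) :=
    Complex.continuous_im.comp_continuousOn hS
  have hJ := (continuous_besselJ hν.le).continuousOn (s := Set.Icc 0 w)
  -- The rotation by `(w - t) sin φ` absorbs the homogeneous part of the equation. The extra `J_ν/2`
  -- cancels the forcing in the imaginary part and the term `J_{ν+1}/2`, leaving `ν/t + cos φ`.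
  have h := intervalIntegral.integral_eq_sub_of_hasDerivAt_of_le
    (f := fun t => Real.cos ((w - t) * Real.sin φ) * (besselSeries ν φ t).im
      + Real.sin ((w - t) * Real.sin φ) * ((besselSeries ν φ t).re + besselJ ν t / 2))
    (f' := fun t => 1 / 2 * f₂Integrand ν w φ t) hw
    (((by fun_prop : ContinuousOn (fun t : ℝ => Real.cos ((w - t) * Real.sin φ)) _).mul hD).add
      ((by fun_prop : ContinuousOn (fun t : ℝ => Real.sin ((w - t) * Real.sin φ)) _).mul
        (hC.add (hJ.div_const 2))))
    (fun t ht => by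
      have hlin := hasDerivAt_sub_mul w (Real.sin φ) t
      refine ((hlin.cos.mul (hasDerivAt_besselSeries_im φ hν.le ht.1)).add
        (hlin.sin.mul ((hasDerivAt_besselSeries_re φ hν.le ht.1).add
          ((hasDerivAt_besselJ hν.le ht.1).div_const 2)))).congr_deriv ?_
      simp only [f₂Integrand, Pi.add_apply]
      ring)
    ((intervalIntegrable_f₂Integrand hν hw φ).const_mul _)
  rw [intervalIntegral.integral_const_mul] at h
  rw [f₂, h]
  simp [besselSeries_zero φ hν.le, besselJ_at_zero hν]

/-- The kernel `K` stands for `sin((w - t) sin φ) / sin φ` or its limit `w - t`, so that both cases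
of `f₁` share one integration by parts. -/
theorem integral_mul_f₁Bracket {ν w : ℝ} (hν : 0 < ν) (hw : 0 ≤ w) (φ : ℝ) {K : ℝ → ℝ}
    (hKd : ∀ t, HasDerivAt K (-Real.cos ((w - t) * Real.sin φ)) t) (hKw : K w = 0)
    (hKs : ∀ t, Real.sin ((w - t) * Real.sin φ) = Real.sin φ * K t) :
    1 / 4 * ∫ t in (0 : ℝ)..w, K t * f₁Bracket ν φ t = (besselSeries ν φ w).re := by
  have hKc : Continuous K := continuous_iff_continuousAt.2 fun t => (hKd t).continuousAt
  have hS := continuousOn_besselSeries φ hν.le w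
  have hC : ContinuousOn (fun t => (besselSeries ν φ t).re) (Set.Icc 0 w) :=
    Complex.continuous_re.comp_continuousOn hS
  have hD : ContinuousOn (fun t => (besselSeries ν φ t).im) (Set.Icc 0 w) :=
    Complex.continuous_im.comp_continuousOn hS
  have hJ := (continuous_besselJ hν.le).continuousOn (s := Set.Icc 0 w)
  have hJ1 := (continuous_besselJ (μ := ν + 1) (by positivity)).continuousOn (s := Set.Icc 0 w)
  -- The first two terms are the real part of the rotated series; since `K' = -cos((w - t) sin φ)`,
  -- the last one trades the forcing for its derivative.
  have h := intervalIntegral.integral_eq_sub_of_hasDerivAt_of_le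
    (f := fun t => Real.cos ((w - t) * Real.sin φ) * (besselSeries ν φ t).re
      - Real.sin ((w - t) * Real.sin φ) * (besselSeries ν φ t).im
      + K t * ((Real.cos φ * besselJ ν t + besselJ (ν + 1) t) / 2))
    (f' := fun t => 1 / 4 * (K t * f₁Bracket ν φ t)) hw
    ((((by fun_prop : ContinuousOn (fun t : ℝ => Real.cos ((w - t) * Real.sin φ)) _).mul hC).sub
      ((by fun_prop : ContinuousOn (fun t : ℝ => Real.sin ((w - t) * Real.sin φ)) _).mul hD)).add
        (hKc.continuousOn.mul (((continuousOn_const.mul hJ).add hJ1).div_const 2)))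
    (fun t ht => by
      have hlin := hasDerivAt_sub_mul w (Real.sin φ) t
      have hJd := hasDerivAt_besselJ hν.le ht.1
      refine (((hlin.cos.mul (hasDerivAt_besselSeries_re φ hν.le ht.1)).sub
        (hlin.sin.mul (hasDerivAt_besselSeries_im φ hν.le ht.1))).add
          ((hKd t).mul (((hJd.const_mul (Real.cos φ)).add
            (hasDerivAt_besselJ_add_one hν.le ht.1)).div_const 2))).congr_deriv ?_
      simp only [f₁Bracket, hJd.deriv, Pi.add_apply]
      have hcos : Real.cos (2 * φ) = 1 - 2 * Real.sin φ ^ 2 := by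
        rw [Real.cos_two_mul, Real.cos_sq']
        ring
      rw [hcos]
      -- The remaining sine term becomes `-sin² φ · K J_ν / 2`, which with `K J_ν / 4` from
      -- `J_{ν+1}'` produces the coefficient `cos 2φ`.
      linear_combination (-(Real.sin φ * besselJ ν t) / 2) * hKs t)
    ((intervalIntegrable_mul_f₁Bracket hν hw φ hKc).const_mul _)
  rw [intervalIntegral.integral_const_mul] at h
  rw [h]
  simp [besselSeries_zero φ hν.le, besselJ_at_zero hν, besselJ_at_zero (add_pos hν one_pos), hKw]

theorem f₁_eq_besselSeries_re {ν w : ℝ} (hν : 0 < ν) (hw : 0 ≤ w) (φ : ℝ) :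
    f₁ ν w φ = (besselSeries ν φ w).re := by
  by_cases hs : Real.sin φ = 0
  · rw [f₁, if_pos hs]
    refine integral_mul_f₁Bracket hν hw φ (fun t => ?_) (sub_self w) fun t => ?_
    · simpa [hs] using (hasDerivAt_id t).const_sub w
    · simp [hs]
  · rw [f₁, if_neg hs, mul_assoc, ← intervalIntegral.integral_const_mul]
    simp only [← mul_assoc]
    refine integral_mul_f₁Bracket (K := fun t => 1 / Real.sin φ * Real.sin ((w - t) * Real.sin φ))
      hν hw φ (fun t => ?_) (by simp) fun t => ?_
    · refine ((hasDerivAt_sub_mul w (Real.sin φ) t).sin.const_mul _).congr_deriv ?_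
      field_simp
    · field_simp

theorem f₁_add_I_mul_f₂ {ν w : ℝ} (hν : 0 < ν) (hw : 0 ≤ w) (φ : ℝ) :
    ((f₁ ν w φ : ℝ) : ℂ) + Complex.I * ((f₂ ν w φ : ℝ) : ℂ) = besselSeries ν φ w := by
  rw [f₁_eq_besselSeries_re hν hw, f₂_eq_besselSeries_im hν hw, mul_comm, Complex.re_add_im]

theorem besselSeries_neg (ν φ w : ℝ) :
    besselSeries ν (-φ) w = starRingEnd ℂ (besselSeries ν φ w) := by
  rw [besselSeries, besselSeries, Complex.conj_tsum]
  refine tsum_congr fun m => ?_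
  rw [besselMode, besselMode, map_mul, Complex.conj_ofReal, ← Complex.exp_conj, map_mul,
    Complex.conj_I, Complex.conj_ofReal, mul_neg, Complex.ofReal_neg, neg_mul, mul_neg]

theorem f₁_sub_I_mul_f₂ {ν w : ℝ} (hν : 0 < ν) (hw : 0 ≤ w) (φ : ℝ) :
    ((f₁ ν w φ : ℝ) : ℂ) - Complex.I * ((f₂ ν w φ : ℝ) : ℂ) = besselSeries ν (-φ) w := by
  rw [besselSeries_neg, ← f₁_add_I_mul_f₂ hν hw]
  simp [sub_eq_add_neg]

/-! ### Splitting the kernel modulo three -/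

/-- The product `e^{ikα} J_{k/3}(w)`; the term of index `k` of the kernel is a sum of two of
these. -/
noncomputable def thirdMode (α w : ℝ) (k : ℕ) : ℂ :=
  Complex.exp (((k * α : ℝ) : ℂ) * Complex.I) * ((besselJ ((k : ℝ) / 3) w : ℝ) : ℂ)

theorem thirdMode_mul_three_add (α w : ℝ) (j m : ℕ) :
    thirdMode α w (3 * m + j)
      = Complex.exp (((j * α : ℝ) : ℂ) * Complex.I) * besselMode ((j : ℝ) / 3) (3 * α) m w := by
  rw [thirdMode, besselMode, ← mul_assoc, ← Complex.exp_add,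
    show (((3 * m + j : ℕ) : ℝ)) / 3 = (j : ℝ) / 3 + m by push_cast; ring]
  congr 2
  push_cast
  ring

theorem summable_thirdMode_residue {w : ℝ} (hw : 0 ≤ w) (α : ℝ) (j : ℕ) :
    Summable fun m => thirdMode α w (3 * m + j) := by
  simp only [thirdMode_mul_three_add]
  exact (summable_besselMode _ (by positivity) hw).mul_left _

theorem tsum_thirdMode_residue (α w : ℝ) (j : ℕ) :
    ∑' m : ℕ, thirdMode α w (3 * (m + 1) + j)
      = Complex.exp (((j * α : ℝ) : ℂ) * Complex.I) * besselSeries ((j : ℝ) / 3) (3 * α) w := by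
  simp only [thirdMode_mul_three_add, besselSeries, tsum_mul_left]

theorem summable_of_residue_classes {f : ℕ → ℂ} (N : ℕ) [NeZero N]
    (h : ∀ j : ℕ, Summable fun m => f (N * m + j)) : Summable f := by
  rw [← summable_norm_iff, ← (Nat.residueClassesEquiv N).symm.summable_iff]
  refine (summable_prod_of_nonneg fun _ => norm_nonneg _).2 ⟨fun j => ?_, .of_finite⟩
  simpa [Nat.residueClassesEquiv, add_comm] using (h j.val).norm

theorem summable_thirdMode {w : ℝ} (hw : 0 ≤ w) (α : ℝ) : Summable (thirdMode α w) :=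
  summable_of_residue_classes 3 fun j => summable_thirdMode_residue hw α j

theorem kernelVar_six (z : ℝ) : kernelVar 6 z = z ^ 3 / 3 := by
  rw [kernelVar, show (6 : ℝ) / 2 = ((3 : ℕ) : ℝ) by norm_num, Real.rpow_natCast]
  ring

theorem kernelTerm_six (z θ : ℝ) (k : ℕ) :
    kernelTerm 6 z (Real.cos θ) k = thirdMode (θ - Real.pi / 6) (z ^ 3 / 3) k
      + thirdMode (-(θ + Real.pi / 6)) (z ^ 3 / 3) k := by
  have h1 : Complex.exp (((k * (θ - Real.pi / 6) : ℝ) : ℂ) * Complex.I)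
      = Complex.exp (-(Complex.I * (Real.pi : ℂ) * (k : ℂ) / ((6 : ℝ) : ℂ)))
        * Complex.exp (((k * θ : ℝ) : ℂ) * Complex.I) := by
    rw [← Complex.exp_add]
    congr 1
    push_cast
    ring
  have h2 : Complex.exp (((k * (-(θ + Real.pi / 6)) : ℝ) : ℂ) * Complex.I)
      = Complex.exp (-(Complex.I * (Real.pi : ℂ) * (k : ℂ) / ((6 : ℝ) : ℂ)))
        * Complex.exp (-((k * θ : ℝ) : ℂ) * Complex.I) := by
    rw [← Complex.exp_add]
    congr 1
    push_cast
    ring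
  have h3 : 2 * ((Real.cos (k * θ) : ℝ) : ℂ) = Complex.exp (((k * θ : ℝ) : ℂ) * Complex.I)
      + Complex.exp (-((k * θ : ℝ) : ℂ) * Complex.I) := by
    rw [Complex.ofReal_cos, Complex.two_cos]
  rw [kernelTerm, kernelVar_six, Polynomial.Chebyshev.T_real_cos, thirdMode, thirdMode, h1, h2,
    show 2 * (k : ℝ) / 6 = (k : ℝ) / 3 by ring]
  push_cast at h3 ⊢
  linear_combination (Complex.exp (-(Complex.I * (Real.pi : ℂ) * (k : ℂ) / 6))
    * ((besselJ ((k : ℝ) / 3) (z ^ 3 / 3) : ℝ) : ℂ)) * h3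

theorem tsum_thirdMode_succ {w : ℝ} (hw : 0 ≤ w) (α : ℝ) :
    ∑' k : ℕ, thirdMode α w (k + 1)
      = thirdMode α w 1 + thirdMode α w 2 + besselSeries 0 (3 * α) w
        + Complex.exp ((α : ℂ) * Complex.I) * besselSeries (1 / 3) (3 * α) w
        + Complex.exp (((2 * α : ℝ) : ℂ) * Complex.I) * besselSeries (2 / 3) (3 * α) w := by
  have hs := summable_thirdMode hw α
  have e0 := (summable_thirdMode_residue hw α 0).tsum_eq_zero_add
  have e1 := (summable_thirdMode_residue hw α 1).tsum_eq_zero_add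
  have e2 := (summable_thirdMode_residue hw α 2).tsum_eq_zero_add
  rw [tsum_thirdMode_residue] at e0 e1 e2
  have h := Nat.sumByResidueClasses hs 3
  have hz := hs.tsum_eq_zero_add
  have hsum : ∑ j : ZMod 3, ∑' m : ℕ, thirdMode α w (j.val + 3 * m)
      = ∑' m : ℕ, thirdMode α w (3 * m + 0) + ∑' m : ℕ, thirdMode α w (3 * m + 1)
        + ∑' m : ℕ, thirdMode α w (3 * m + 2) := by
    simp only [add_comm _ (3 * _)]
    exact Fin.sum_univ_three _
  rw [hsum, e0, e1, e2] at h
  norm_num at h hz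
  push_cast
  -- The term `k = 0` occurs both in the residue class of `0` and in the full sum, and cancels.
  linear_combination h - hz

/-! ### The explicit kernel -/

theorem theorem2p8 (z θ : ℝ) (hz : 0 ≤ z) :
    -- the series that defines the kernel converges absolutely
    Summable (fun k : ℕ => ‖kernelTerm 6 z (Real.cos θ) (k + 1)‖) ∧
    -- the integrals that define `f₁` and `f₂` converge
    (∀ k ∈ Finset.Icc (1 : ℕ) 2, ∀ φ : ℝ,
      IntervalIntegrable (fun t => (z ^ 3 / 3 - t) * f₁Bracket ((k : ℝ) / 3) φ t)
        MeasureTheory.volume 0 (z ^ 3 / 3) ∧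
      IntervalIntegrable
        (fun t => Real.sin ((z ^ 3 / 3 - t) * Real.sin φ) * f₁Bracket ((k : ℝ) / 3) φ t)
        MeasureTheory.volume 0 (z ^ 3 / 3) ∧
      IntervalIntegrable (f₂Integrand ((k : ℝ) / 3) (z ^ 3 / 3) φ)
        MeasureTheory.volume 0 (z ^ 3 / 3)) ∧
    -- the explicit expression of the kernel
    deformedKernel2 6 z (Real.cos θ) =
      Complex.exp (-(Complex.I * ((z ^ 3 / 3 : ℝ) : ℂ) * ((Real.cos (3 * θ) : ℝ) : ℂ)))
      + 2 * Complex.exp (-(Complex.I * (Real.pi : ℂ) / 6))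
          * ((besselJ (1 / 3) (z ^ 3 / 3) : ℝ) : ℂ) * ((Real.cos θ : ℝ) : ℂ)
      + 2 * Complex.exp (-(Complex.I * (Real.pi : ℂ) / 3))
          * ((besselJ (2 / 3) (z ^ 3 / 3) : ℝ) : ℂ) * ((Real.cos (2 * θ) : ℝ) : ℂ)
      + ∑ k ∈ Finset.Icc (1 : ℕ) 2,
          Complex.exp (Complex.I * (k : ℂ) * ((θ - Real.pi / 6 : ℝ) : ℂ))
            * (((f₁ ((k : ℝ) / 3) (z ^ 3 / 3) (3 * θ - Real.pi / 2) : ℝ) : ℂ)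
              + Complex.I * ((f₂ ((k : ℝ) / 3) (z ^ 3 / 3) (3 * θ - Real.pi / 2) : ℝ) : ℂ))
      + ∑ k ∈ Finset.Icc (1 : ℕ) 2,
          Complex.exp (-(Complex.I * (k : ℂ) * ((θ + Real.pi / 6 : ℝ) : ℂ)))
            * (((f₁ ((k : ℝ) / 3) (z ^ 3 / 3) (3 * θ + Real.pi / 2) : ℝ) : ℂ)
              - Complex.I * ((f₂ ((k : ℝ) / 3) (z ^ 3 / 3) (3 * θ + Real.pi / 2) : ℝ) : ℂ)) := by
  have hw : 0 ≤ z ^ 3 / 3 := by positivity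
  have hs1 := (summable_nat_add_iff 1).2 (summable_thirdMode hw (θ - Real.pi / 6))
  have hs2 := (summable_nat_add_iff 1).2 (summable_thirdMode hw (-(θ + Real.pi / 6)))
  refine ⟨?_, fun k hk φ => ?_, ?_⟩
  · simp only [kernelTerm_six]
    exact (hs1.add hs2).norm
  · have hk0 : (0 : ℝ) < (k : ℝ) / 3 := by
      have : 0 < k := (Finset.mem_Icc.1 hk).1
      positivity
    exact ⟨intervalIntegrable_mul_f₁Bracket hk0 hw φ (by fun_prop),
      intervalIntegrable_mul_f₁Bracket hk0 hw φ (by fun_prop),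
      intervalIntegrable_f₂Integrand hk0 hw φ⟩
  · have hJA := jacobi_anger (3 * θ) hw
    have hν1 : (0 : ℝ) < 1 / 3 := by norm_num
    have hν2 : (0 : ℝ) < 2 / 3 := by norm_num
    have t1 := kernelTerm_six z θ 1
    have t2 := kernelTerm_six z θ 2
    have b1 : 3 * (θ - Real.pi / 6) = 3 * θ - Real.pi / 2 := by ring
    have b2 : 3 * (-(θ + Real.pi / 6)) = -(3 * θ + Real.pi / 2) := by ring
    have hser : ∑' k : ℕ, kernelTerm 6 z (Real.cos θ) (k + 1)
        = ∑' k : ℕ, thirdMode (θ - Real.pi / 6) (z ^ 3 / 3) (k + 1)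
          + ∑' k : ℕ, thirdMode (-(θ + Real.pi / 6)) (z ^ 3 / 3) (k + 1) := by
      simp only [kernelTerm_six]
      exact hs1.tsum_add hs2
    rw [deformedKernel2, hser, tsum_thirdMode_succ hw, tsum_thirdMode_succ hw, b1, b2,
      kernelVar_six, ← hJA]
    have hIcc : Finset.Icc (1 : ℕ) 2 = {1, 2} := rfl
    simp only [hIcc, Finset.sum_pair (show (1 : ℕ) ≠ 2 by norm_num), Nat.cast_one, Nat.cast_ofNat,
      f₁_add_I_mul_f₂ hν1 hw, f₁_add_I_mul_f₂ hν2 hw, f₁_sub_I_mul_f₂ hν1 hw,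
      f₁_sub_I_mul_f₂ hν2 hw]
    rw [kernelTerm, kernelVar_six, Polynomial.Chebyshev.T_real_cos] at t1 t2
    have c2 : Complex.exp (-(Complex.I * (Real.pi : ℂ) / 3))
        = Complex.exp (-(Complex.I * (Real.pi : ℂ) * 2 / 6)) := by
      congr 1
      ring
    have x1 : Complex.I * 1 * ((θ - Real.pi / 6 : ℝ) : ℂ)
        = ((θ - Real.pi / 6 : ℝ) : ℂ) * Complex.I := by ring
    have x2 : Complex.I * 2 * ((θ - Real.pi / 6 : ℝ) : ℂ)
        = ((2 * (θ - Real.pi / 6) : ℝ) : ℂ) * Complex.I := by push_cast; ring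
    have y1 : -(Complex.I * 1 * ((θ + Real.pi / 6 : ℝ) : ℂ))
        = ((-(θ + Real.pi / 6) : ℝ) : ℂ) * Complex.I := by push_cast; ring
    have y2 : -(Complex.I * 2 * ((θ + Real.pi / 6 : ℝ) : ℂ))
        = ((2 * -(θ + Real.pi / 6) : ℝ) : ℂ) * Complex.I := by push_cast; ring
    rw [x1, x2, y1, y2, c2]
    norm_num [-neg_add_rev] at t1 t2
    push_cast
    -- After the rewriting by `hJA`, all series occur identically on both sides; only the explicit
    -- terms `k = 1, 2` remain to be matched.
    linear_combination -t1 - t2
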